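/- Let $G$ be a compact topological group. A $G$-space is a topological space with a continuous action of $G$, a $G$-map is a continuous equivariant map, and $\simeq_G$ denotes $G$-homotopy of $G$-maps. A $G$-ANR is a metrizable $G$-space $Y$ such that, whenever $Y$ is embedded as a closed invariant subset of a metrizable $G$-space $Z$, there is an invariant neighborhood $U$ of $Y$ in $Z$ and a $G$-retraction $U\to Y$. An inverse $G$-ANR system $\{X_\alpha,p_{\alpha\alpha'},A\}$ consists of a nonempty directed index set $A$, $G$-ANRs $X_\alpha$ and $G$-maps $p_{\alpha\alpha'}:X_{\alpha'}\to X_\alpha$ ($\alpha\le\alpha'$) with $p_{\alpha\alpha}=\mathrm{id}$ and $p_{\alpha\alpha'}p_{\alpha'\alpha''}=p_{\alpha\alpha''}$; it is a $G$-ANR sequence if $A=\mathbb N$. It is associated with a $G$-space $X$ if there are $G$-maps $p_\alpha:X\to X_\alpha$ with $p_\alpha\simeq_G p_{\alpha\alpha'}p_{\alpha'}$ for $\alpha\le\alpha'$ such that for every $G$-ANR $P$: (1) for every $G$-map $f:X\to P$ there are $\alpha\in A$ and a $G$-map $h:X_\alpha\to P$ with $hp_\alpha\simeq_G f$; (2)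 if $\varphi,\psi:X_\alpha\to P$ are $G$-maps with $\varphi p_\alpha\simeq_G\psi p_\alpha$, then $\varphi p_{\alpha\alpha'}\simeq_G\psi p_{\alpha\alpha'}$ for some $\alpha'\ge\alpha$. The system is $G$-movable if for every $\alpha$ there is $\alpha'\ge\alpha$ such that for every $\alpha''\ge\alpha$ there is a $G$-map $r:X_{\alpha'}\to X_{\alpha''}$ with $p_{\alpha\alpha''}r\simeq_G p_{\alpha\alpha'}$. A $G$-space is $G$-movable if some $G$-movable inverse $G$-ANR system is associated with it. A $G$-shape morphism $X\to Y$ is a morphism, in the pro-category of the $G$-homotopy category, from an inverse $G$-ANR system $\{X_\alpha,p_{\alpha\alpha'},A\}$ associated with $X$ to an inverse $G$-ANR system $\{Y_\beta,q_{\beta\beta'},B\}$ associated with $Y$; it is represented by a function $\varphi:B\to A$ and $G$-maps $f_\beta:X_{\varphi(\beta)}\to Y_\beta$ such that for all $\beta\le\beta'$ there is $\alpha\ge\varphi(\beta),\varphi(\beta')$ with $f_\beta p_{\varphi(\beta)\alpha}\simeq_G q_{\beta\beta'}f_{\beta'}p_{\varphi(\beta')\alpha}$. Two $G$-spaces $X,Y$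 are weakly equivariantly shape comparable if there are $G$-shape morphisms $X\to Y$ and $Y\to X$; $wes(X)$ denotes the class of all $G$-spaces weakly equivariantly shape comparable with $X$. Theorem. Let $K=wes(Z)$ be the weak equivariant shape comparability class of some $G$-space $Z$, and suppose that $K$ contains a compact metrizable $G$-movable $G$-space. Then for every compact metrizable $G$-space $X\in K$ there is a $G$-ANR sequence $\{X_k,p_{k,l}\}$ associated with $X$ such that $X_k\in K$ for every $k\in\mathbb N$. -/

import Mathlib

universe u

/-- A `G`-space: a topological space with a (jointly) continuous action of `G`. -/
structure GSpace (G : Type u) [Group G] [TopologicalSpace G] : Type (u + 1) where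
  carrier : Type u
  [top : TopologicalSpace carrier]
  [act : MulAction G carrier]
  [cont : ContinuousSMul G carrier]

namespace GSpace

variable {G : Type u} [Group G] [TopologicalSpace G]

instance : CoeSort (GSpace G) (Type u) := ⟨GSpace.carrier⟩

instance (X : GSpace G) : TopologicalSpace X := X.top

instance (X : GSpace G) : MulAction G X := X.act

instance (X : GSpace G) : ContinuousSMul G X := X.cont

end GSpace

/-- Equivariance of a continuous map between `G`-spaces. -/
def IsEquivariant {G : Type u} [Group G] [TopologicalSpace G] {X Y : GSpace G} (f : C(X, Y)) :
    Prop :=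
  ∀ (g : G) (x : X), f (g • x) = g • f x

/-- A `G`-map: a continuous equivariant map. -/
structure GMap {G : Type u} [Group G] [TopologicalSpace G] (X Y : GSpace G) : Type u where
  toMap : C(X, Y)
  equivariant : IsEquivariant toMap

namespace GMap

variable {G : Type u} [Group G] [TopologicalSpace G] {X Y Z : GSpace G}

instance : CoeFun (GMap X Y) (fun _ => X → Y) := ⟨fun f => f.toMap⟩

/-- The identity `G`-map. -/
def id (X : GSpace G) : GMap X X := ⟨ContinuousMap.id X, fun _ _ => rfl⟩

/-- Composition of `G`-maps, `f` after `h`. -/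
def comp (f : GMap Y Z) (h : GMap X Y) : GMap X Z :=
  ⟨f.toMap.comp h.toMap, fun g x => by
    change f.toMap (h.toMap (g • x)) = g • f.toMap (h.toMap x)
    rw [h.equivariant, f.equivariant]⟩

/-- `G`-homotopy of `G`-maps: a homotopy `I × X → Y` all of whose stages are equivariant, that is,
a homotopy which is a `G`-map for the trivial action of `G` on `I`. -/
def Homotopic (f h : GMap X Y) : Prop :=
  ContinuousMap.HomotopicWith f.toMap h.toMap IsEquivariant

end GMap

/-- `Y` is a `G`-ANR (for the class of metrizable `G`-spaces): `Y` is metrizable, and whenever `Y`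
is embedded as a closed invariant subset of a metrizable `G`-space `Z`, there are an invariant
neighbourhood `U` of `Y` in `Z` and a `G`-retraction `r : U → Y`. -/
def IsGANR {G : Type u} [Group G] [TopologicalSpace G] (Y : GSpace G) : Prop :=
  TopologicalSpace.MetrizableSpace Y ∧
    ∀ (Z : GSpace G), TopologicalSpace.MetrizableSpace Z →
      ∀ i : GMap Y Z, Topology.IsClosedEmbedding i →
        ∃ (U : Set Z) (hU : ∀ (g : G) (z : Z), z ∈ U → g • z ∈ U) (hY : ∀ y, i y ∈ U)
          (r : U → Y),
          U ∈ nhdsSet (Set.range i) ∧ Continuous r ∧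
            (∀ (g : G) (z : U), r ⟨g • (z : Z), hU g z z.2⟩ = g • r z) ∧
            ∀ y, r ⟨i y, hY y⟩ = y

/-- An inverse system of `G`-ANRs and `G`-maps indexed by `A`; `bond α α' _ : X_α' → X_α` for
`α ≤ α'`. It is used for directed nonempty `A` only. -/
structure GANRSystem (G : Type u) [Group G] [TopologicalSpace G] (A : Type*) [Preorder A] where
  obj : A → GSpace G
  isGANR : ∀ α, IsGANR (obj α)
  bond : ∀ α α' : A, α ≤ α' → GMap (obj α') (obj α)
  bond_self : ∀ α, bond α α le_rfl = GMap.id (obj α)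
  bond_comp : ∀ (α α' α'' : A) (h : α ≤ α') (h' : α' ≤ α''),
    (bond α α' h).comp (bond α' α'' h') = bond α α'' (h.trans h')

namespace GANRSystem

variable {G : Type u} [Group G] [TopologicalSpace G]

/-- The system `S` is associated with the `G`-space `X`. -/
def IsAssociated {A : Type*} [Preorder A] (S : GANRSystem G A) (X : GSpace G) : Prop :=
  ∃ p : ∀ α, GMap X (S.obj α),
    (∀ (α α' : A) (h : α ≤ α'), (p α).Homotopic ((S.bond α α' h).comp (p α'))) ∧
    ∀ P : GSpace G, IsGANR P →
      (∀ f : GMap X P, ∃ (α : A) (h : GMap (S.obj α) P), (h.comp (p α)).Homotopic f) ∧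
      ∀ (α : A) (φ ψ : GMap (S.obj α) P), (φ.comp (p α)).Homotopic (ψ.comp (p α)) →
        ∃ (α' : A) (h : α ≤ α'),
          (φ.comp (S.bond α α' h)).Homotopic (ψ.comp (S.bond α α' h))

/-- The system `S` is `G`-movable. -/
def IsMovable {A : Type*} [Preorder A] (S : GANRSystem G A) : Prop :=
  ∀ α : A, ∃ (α' : A) (h' : α ≤ α'), ∀ (α'' : A) (h'' : α ≤ α''),
    ∃ r : GMap (S.obj α') (S.obj α''), ((S.bond α α'' h'').comp r).Homotopic (S.bond α α' h')

/-- A map of inverse systems `(f_β, φ) : S → T`, up to `G`-homotopy. These represent the morphisms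
`S → T` of the pro-category of the `G`-homotopy category. -/
structure Map {A B : Type*} [Preorder A] [Preorder B] (S : GANRSystem G A) (T : GANRSystem G B) where
  φ : B → A
  f : ∀ β, GMap (S.obj (φ β)) (T.obj β)
  comm : ∀ (β β' : B) (h : β ≤ β'), ∃ (α : A) (h₁ : φ β ≤ α) (h₂ : φ β' ≤ α),
    ((f β).comp (S.bond (φ β) α h₁)).Homotopic
      ((T.bond β β' h).comp ((f β').comp (S.bond (φ β') α h₂)))

end GANRSystem

section Shape

variable {G : Type u} [Group G] [TopologicalSpace G]

/-- `X` is `G`-movable: some inverse `G`-ANR system associated with `X` is `G`-movable. -/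
def IsGMovable (X : GSpace G) : Prop :=
  ∃ (A : Type u) (_ : Preorder A) (_ : Nonempty A) (_ : IsDirectedOrder A) (S : GANRSystem G A),
    S.IsAssociated X ∧ S.IsMovable

/-- There is a `G`-shape morphism `X → Y`. A `G`-shape morphism is represented by a map between
inverse `G`-ANR systems associated with `X` and with `Y`; since only existence matters here, the
identification of equivalent representatives is not needed. -/
def ExistsGShapeMorphism (X Y : GSpace G) : Prop :=
  ∃ (A : Type u) (_ : Preorder A) (_ : Nonempty A) (_ : IsDirectedOrder A) (S : GANRSystem G A)
    (B : Type u) (_ : Preorder B) (_ : Nonempty B) (_ : IsDirectedOrder B) (T : GANRSystem G B),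
    S.IsAssociated X ∧ T.IsAssociated Y ∧ Nonempty (S.Map T)

/-- `X` and `Y` are weakly equivariantly shape comparable. -/
def WeaklyGShapeComparable (X Y : GSpace G) : Prop :=
  ExistsGShapeMorphism X Y ∧ ExistsGShapeMorphism Y X

/-- The class `wes(X)` of the `G`-spaces weakly equivariantly shape comparable with `X`. -/
def wes (X : GSpace G) : Set (GSpace G) := {Y | WeaklyGShapeComparable X Y}

end Shape

/-! For a normed space `E`, a `G`-map into `C(G, E)` is determined by its composite with evaluation
at `1`, which may be any continuous map to `E`. Dugundji's theorem therefore makes `C(G, E)` an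
equivariant absolute extensor with no averaging over `G`, and its open invariant subsets are
`G`-ANRs. A compact metrizable `X` embeds equivariantly in such a space. The action there is
isometric, so metric neighbourhoods of the image are invariant; they form a `G`-ANR sequence
associated with `X` (`exists_isAssociated_nat`), because `G`-ANRs are neighbourhood extensors for
maps and for homotopies.

Let `S` and `T` be such sequences for `X` and for the movable space `Y`. Movability is independent
of the associated system, so `T` is movable, and iterating movability yields a compatible family of
classes from one term `T_m` to all of `T`, that is, a shape morphism `T_m → Y`. A shape morphism `X
→ Y` contains a `G`-map `S_i → T_m` for some `i`. For `k ≥ i` this gives `Z → X → S_k` and `S_k →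
S_i → T_m → Y → Z`, so the tail of `S` lies in the class. -/

open Topology Metric

/-! ### Dugundji extension. -/

/-- **Dugundji's extension theorem**: a continuous map from a closed subspace of a metrizable space
to a normed space extends to the whole space. -/
theorem exists_continuousMap_extension {Y Z E : Type*} [TopologicalSpace Y] [TopologicalSpace Z]
    [TopologicalSpace.MetrizableSpace Z] [NormedAddCommGroup E] [NormedSpace ℝ E]
    {i : Y → Z} (hi : IsClosedEmbedding i) (f : C(Y, E)) :
    ∃ F : C(Z, E), ∀ y, F (i y) = f y := by
  let _ := TopologicalSpace.metrizableSpaceMetric Z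
  rcases isEmpty_or_nonempty Y with hY | hY
  · exact ⟨0, fun y => (hY.false y).elim⟩
  set A := Set.range i
  have hA : IsClosed A := hi.isClosed_range
  have hne : A.Nonempty := Set.range_nonempty i
  -- Off `A`, the extension is a continuous selection of convex combinations of values of `f` at
  -- nearly closest points. Since `infDist z A > 0`, the factor 2 guarantees that such points exist,
  -- and each one stays admissible near `z`.
  let t : (Aᶜ : Set Z) → Set E := fun z =>
    convexHull ℝ (f '' {y | dist (z : Z) (i y) < 2 * infDist (z : Z) A})
  obtain ⟨g, hg⟩ := exists_continuous_forall_mem_convex_of_local_const (t := t)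
    (fun z => convex_convexHull _ _) (fun z => by
      have hpos : 0 < infDist (z : Z) A := (hA.notMem_iff_infDist_pos hne).1 z.2
      obtain ⟨_, ⟨y, rfl⟩, hy⟩ := (infDist_lt_iff hne).1
        (show infDist (z : Z) A < 2 * infDist (z : Z) A by linarith)
      refine ⟨f y, ?_⟩
      have ho : IsOpen {w : (Aᶜ : Set Z) | dist (w : Z) (i y) < 2 * infDist (w : Z) A} :=
        isOpen_lt (by fun_prop)
          (continuous_const.mul ((continuous_infDist_pt A).comp continuous_subtype_val))
      filter_upwards [ho.mem_nhds hy] with w hw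
      exact subset_convexHull ℝ _ ⟨y, hw, rfl⟩)
  classical
  let F : Z → E := fun z => if h : z ∈ A then f h.choose else g ⟨z, h⟩
  have hFi : ∀ y, F (i y) = f y := fun y => by
    have h : i y ∈ A := ⟨y, rfl⟩
    simp only [F, dif_pos h]
    exact congrArg f (hi.injective h.choose_spec)
  refine ⟨⟨F, continuous_iff_continuousAt.2 fun z => ?_⟩, hFi⟩
  by_cases hz : z ∈ A
  · obtain ⟨y, rfl⟩ := hz
    rw [ContinuousAt, hFi, Metric.tendsto_nhds_nhds]
    intro ε hε
    have hU : f ⁻¹' ball (f y) ε ∈ 𝓝 y := f.continuous.continuousAt (ball_mem_nhds _ hε)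
    rw [hi.isInducing.nhds_eq_comap, Metric.nhds_basis_ball.comap i |>.mem_iff] at hU
    obtain ⟨δ, hδ, hU⟩ := hU
    -- A point within twice the distance from `w` to `A` is within `3 * dist w (i y)` of `i y`,
    -- hence the third.
    refine ⟨δ / 3, by positivity, fun {w} hw => ?_⟩
    by_cases hwA : w ∈ A
    · obtain ⟨y', rfl⟩ := hwA
      rw [hFi]
      exact hU (show dist (i y') (i y) < δ by linarith)
    · have hFw : F w = g ⟨w, hwA⟩ := dif_neg hwA
      rw [hFw]
      have hsub : t ⟨w, hwA⟩ ⊆ ball (f y) ε := by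
        refine convexHull_min ?_ (convex_ball _ _)
        rintro _ ⟨y', hy', rfl⟩
        have h1 : infDist w A ≤ dist w (i y) := infDist_le_dist_of_mem ⟨y, rfl⟩
        have h2 : dist w (i y') < 2 * infDist w A := hy'
        have h3 := dist_triangle_left (i y') (i y) w
        exact hU (show dist (i y') (i y) < δ by linarith)
      exact hsub (hg _)
  · have hgc : ContinuousOn F Aᶜ := by
      rw [continuousOn_iff_continuous_domRestrict]
      refine g.continuous.congr fun w => ?_
      simp only [Set.domRestrict_apply, F, dif_neg w.2]
    exact hgc.continuousAt (hA.isOpen_compl.mem_nhds hz)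

/-! ### Coinduced `G`-spaces and equivariant neighbourhood extension. -/

section GSpace

variable {G : Type u} [Group G] [TopologicalSpace G]

namespace GSpace

/-- The action on an invariant subset. -/
abbrev subAction (Z : GSpace G) (A : Set Z) (hA : ∀ (g : G) (z : Z), z ∈ A → g • z ∈ A) :
    MulAction G A where
  smul := fun g a => ⟨g • (a : Z), hA g a a.2⟩
  one_smul := fun a => Subtype.ext (one_smul G (a : Z))
  mul_smul := fun g h a => Subtype.ext (mul_smul g h (a : Z))

/-- An invariant subset of a `G`-space, as a `G`-space. -/
def sub (Z : GSpace G) (A : Set Z) (hA : ∀ (g : G) (z : Z), z ∈ A → g • z ∈ A) : GSpace G :=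
  letI := subAction Z A hA
  { carrier := A
    cont := ⟨(continuous_fst.smul (continuous_subtype_val.comp continuous_snd)).subtype_mk _⟩ }

/-- The action on a cylinder. -/
abbrev cylAction (Z : GSpace G) : MulAction G (unitInterval × Z) where
  smul := fun g a => (a.1, g • a.2)
  one_smul := fun a => Prod.ext rfl (one_smul G a.2)
  mul_smul := fun g h a => Prod.ext rfl (mul_smul g h a.2)

/-- The cylinder `I × Z` over a `G`-space, with the trivial action on `I`. -/
def cyl (Z : GSpace G) : GSpace G :=
  letI := cylAction Z
  { carrier := unitInterval × Z
    cont := ⟨(continuous_fst.comp continuous_snd).prodMk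
      (continuous_fst.smul (continuous_snd.comp continuous_snd))⟩ }

variable [IsTopologicalGroup G]

/-- The action of `G` on the continuous maps `G → E` by right translation of the argument. -/
abbrev coindAction (G : Type u) [Group G] [TopologicalSpace G] [IsTopologicalGroup G]
    (E : Type u) [TopologicalSpace E] : MulAction G C(G, E) where
  smul := fun h v => v.comp ⟨fun g => g * h, continuous_mul_const h⟩
  one_smul := fun v => ContinuousMap.ext fun g => congrArg v (mul_one g)
  mul_smul := fun h k v => ContinuousMap.ext fun g => congrArg v (mul_assoc g h k).symm

/-- The `G`-space coinduced by a space `E`: the continuous maps `G → E`, with `G` acting by right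
translation of the argument. -/
def coind (G : Type u) [Group G] [TopologicalSpace G] [IsTopologicalGroup G] [CompactSpace G]
    (E : Type u) [TopologicalSpace E] : GSpace G :=
  letI := coindAction G E
  { carrier := C(G, E)
    cont := ⟨by
      -- The action is composition with a right translation; composition is jointly continuous in
      -- the compact-open topology because `G` is locally compact.
      have h1 : Continuous fun h : G => (⟨fun g => g * h, continuous_mul_const h⟩ : C(G, G)) :=
        ContinuousMap.continuous_of_continuous_uncurry _ (by
          change Continuous fun p : G × G => p.2 * p.1
          fun_prop)
      exact ContinuousMap.continuous_comp'.comp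
        ((h1.comp continuous_fst).prodMk continuous_snd)⟩ }

variable [CompactSpace G] {E : Type u}

/-- Evaluation on a coinduced `G`-space. -/
def ev [TopologicalSpace E] (g : G) : C(coind G E, E) :=
  ⟨fun v : C(G, E) => v g, (continuous_eval_const g : Continuous fun v : C(G, E) => v g)⟩

theorem coind_ext [TopologicalSpace E] {v w : coind G E} (h : ∀ g, ev g v = ev g w) : v = w :=
  ContinuousMap.ext h

@[simp]
theorem ev_smul [TopologicalSpace E] (g h : G) (v : coind G E) : ev g (h • v) = ev (g * h) v := rfl

noncomputable instance [NormedAddCommGroup E] : MetricSpace (coind G E) :=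
  inferInstanceAs (MetricSpace C(G, E))

instance [TopologicalSpace E] [TopologicalSpace.MetrizableSpace E] :
    TopologicalSpace.MetrizableSpace (coind G E) :=
  letI := TopologicalSpace.metrizableSpaceMetric E
  inferInstanceAs (TopologicalSpace.MetrizableSpace C(G, E))

theorem dist_smul_smul [NormedAddCommGroup E] (h : G) (v w : coind G E) :
    dist (h • v) (h • w) = dist v w := by
  have key : ∀ (k : G) (v w : coind G E), dist (k • v) (k • w) ≤ dist v w := fun k v w =>
    (ContinuousMap.dist_le (α := G) (β := E) (f := k • v) (g := k • w) dist_nonneg).2 fun g =>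
      ContinuousMap.dist_apply_le_dist (f := (v : C(G, E))) (g := w) (g * k)
  refine le_antisymm (key h v w) ?_
  simpa using key h⁻¹ (h • v) (h • w)

end GSpace

namespace GMap

/-- The inclusion of an invariant subset. -/
def subVal (Z : GSpace G) (A : Set Z) (hA : ∀ (g : G) (z : Z), z ∈ A → g • z ∈ A) :
    GMap (Z.sub A hA) Z :=
  ⟨⟨Subtype.val, continuous_subtype_val⟩, fun _ _ => rfl⟩

/-- A `G`-map with values in an invariant subset, as a `G`-map to this subset. -/
def codRestrict {X Z : GSpace G} (f : GMap X Z) (A : Set Z)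
    (hA : ∀ (g : G) (z : Z), z ∈ A → g • z ∈ A) (h : ∀ x, f x ∈ A) : GMap X (Z.sub A hA) :=
  ⟨⟨fun x => ⟨f x, h x⟩, f.toMap.continuous.subtype_mk _⟩,
    fun g x => Subtype.ext (f.equivariant g x)⟩

@[ext]
theorem ext {X Y : GSpace G} {f h : GMap X Y} (H : ∀ x, f x = h x) : f = h := by
  cases f; cases h; congr; exact ContinuousMap.ext H

variable [IsTopologicalGroup G] [CompactSpace G]

/-- The `G`-map to a coinduced space which corresponds to a continuous map. -/
def toCoind {Z : GSpace G} {E : Type u} [TopologicalSpace E] (f : C(Z, E)) :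
    GMap Z (GSpace.coind G E) where
  toMap := ContinuousMap.curry ⟨fun p : Z × G => f (p.2 • p.1), by fun_prop⟩
  equivariant := fun g z => ContinuousMap.ext fun k => congrArg f (mul_smul k g z).symm

theorem toCoind_apply {Z : GSpace G} {E : Type u} [TopologicalSpace E] (f : C(Z, E)) (z : Z)
    (g : G) : GSpace.ev g (toCoind f z) = f (g • z) := rfl

theorem isEmbedding_toCoind {Z : GSpace G} {E : Type u} [TopologicalSpace E] (f : C(Z, E))
    (hf : IsEmbedding f) : IsEmbedding (toCoind f) := by
  refine IsEmbedding.of_comp (toCoind f).toMap.continuous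
    (g := GSpace.ev (1 : G)) (GSpace.ev 1).continuous ?_
  convert hf using 1
  ext z
  exact congrArg f (one_smul G z)

/-- A coinduced normed space is an absolute extensor for metrizable `G`-spaces. -/
theorem exists_extension_coind {Y Z : GSpace G} {E : Type u} [NormedAddCommGroup E]
    [NormedSpace ℝ E] [TopologicalSpace.MetrizableSpace Z] (i : GMap Y Z)
    (hi : IsClosedEmbedding i) (f : GMap Y (GSpace.coind G E)) :
    ∃ F : GMap Z (GSpace.coind G E), ∀ y, F (i y) = f y := by
  -- Only the component at `1` is extended; `toCoind` restores equivariance.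
  obtain ⟨F, hF⟩ := exists_continuousMap_extension hi
    ((GSpace.ev 1).comp f.toMap)
  refine ⟨toCoind F, fun y => GSpace.coind_ext fun g => ?_⟩
  rw [toCoind_apply, ← i.equivariant, hF, ContinuousMap.comp_apply, f.equivariant, GSpace.ev_smul,
    one_mul]

end GMap

variable [IsTopologicalGroup G] [CompactSpace G]

/-- The inclusion of `U` extends to a `G`-map from the ambient space to the coinduced space, and
this extension retracts the preimage of `U` onto `U`. -/
theorem isGANR_sub_coind {E : Type u} [NormedAddCommGroup E] [NormedSpace ℝ E]
    (U : Set (GSpace.coind G E)) (hU : ∀ (g : G) (v : GSpace.coind G E), v ∈ U → g • v ∈ U)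
    (hUo : IsOpen U) : IsGANR ((GSpace.coind G E).sub U hU) := by
  refine ⟨inferInstanceAs (TopologicalSpace.MetrizableSpace U),
    fun Z hZ i hi => ?_⟩
  obtain ⟨F, hF⟩ := GMap.exists_extension_coind i hi (GMap.subVal _ U hU)
  refine ⟨F ⁻¹' U, fun g z hz => ?_, fun y => ?_, fun z => ⟨F z, z.2⟩, ?_, ?_, ?_, ?_⟩
  · change F (g • z) ∈ U
    rw [F.equivariant]
    exact hU g _ hz
  · change F (i y) ∈ U
    rw [hF]
    exact y.2
  · refine (hUo.preimage F.toMap.continuous).mem_nhdsSet.2 ?_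
    rintro _ ⟨y, rfl⟩
    change F (i y) ∈ U
    rw [hF]
    exact y.2
  · exact (F.toMap.continuous.comp continuous_subtype_val).subtype_mk _
  · exact fun g z => Subtype.ext (F.equivariant g z)
  · exact fun y => Subtype.ext (hF y)

/-- The Kuratowski embedding with respect to the truncated metric. -/
theorem exists_isEmbedding_boundedContinuousFunction (P : Type*) [TopologicalSpace P]
    [TopologicalSpace.MetrizableSpace P] :
    ∃ i : C(P, BoundedContinuousFunction P ℝ), IsEmbedding i := by
  let _ := TopologicalSpace.metrizableSpaceMetric P
  let i : P → BoundedContinuousFunction P ℝ := fun p =>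
    BoundedContinuousFunction.mkOfBound ⟨fun x => min (dist p x) 1, by fun_prop⟩ 1 fun x y => by
      rw [Real.dist_eq, abs_le]
      have h1 : 0 ≤ min (dist p x) 1 := by positivity
      have h2 : 0 ≤ min (dist p y) 1 := by positivity
      have h3 := min_le_right (dist p x) 1
      have h4 := min_le_right (dist p y) 1
      constructor <;> simp only [ContinuousMap.coe_mk] <;> linarith
  have hiv : ∀ p x, i p x = min (dist p x) 1 := fun _ _ => rfl
  have hup : ∀ p q, dist (i p) (i q) ≤ dist p q := fun p q => by
    refine (BoundedContinuousFunction.dist_le dist_nonneg).2 fun x => ?_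
    rw [hiv, hiv, Real.dist_eq]
    refine (abs_min_sub_min_le_max _ _ _ _).trans ?_
    simpa using abs_dist_sub_le p q x
  have hlow : ∀ p q, min (dist p q) 1 ≤ dist (i p) (i q) := fun p q => by
    -- Evaluation at `q` itself recovers the truncated distance.
    have h := BoundedContinuousFunction.dist_coe_le_dist (f := i p) (g := i q) q
    rw [hiv, hiv, dist_self, Real.dist_eq] at h
    exact (le_abs_self _).trans (by simpa using h)
  have hc : Continuous i := (LipschitzWith.of_dist_le_mul (K := 1) (by simpa using hup)).continuous
  refine ⟨⟨i, hc⟩, ⟨Topology.isInducing_iff_nhds.2 fun p => le_antisymm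
    (Filter.map_le_iff_le_comap.1 hc.continuousAt) ?_, fun p q hpq => ?_⟩⟩
  · refine (Metric.nhds_basis_ball.comap _).le_basis_iff Metric.nhds_basis_ball |>.2 fun ε hε =>
      ⟨min ε 1, by positivity, fun q hq => ?_⟩
    have hq' : dist (i q) (i p) < min ε 1 := hq
    have h1 := (hlow q p).trans_lt hq'
    rw [mem_ball]
    by_contra! h
    exact absurd h1 (not_lt.2 (min_le_min_right 1 h))
  · have h1 := hlow p q
    rw [show i p = i q from hpq, dist_self] at h1
    by_contra hne
    have := dist_pos.2 hne
    have : 0 < min (dist p q) 1 := by positivity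
    linarith

/-- A `G`-ANR is an absolute neighbourhood extensor for metrizable `G`-spaces. -/
theorem IsGANR.exists_extension {P Y Z : GSpace G} (hP : IsGANR P)
    (hZ : TopologicalSpace.MetrizableSpace Z) (i : GMap Y Z) (hi : IsClosedEmbedding i)
    (f : GMap Y P) :
    ∃ (U : Set Z) (hU : ∀ (g : G) (z : Z), z ∈ U → g • z ∈ U) (F : GMap (Z.sub U hU) P),
      U ∈ 𝓝ˢ (Set.range i) ∧ ∀ y (hy : i y ∈ U), F ⟨i y, hy⟩ = f y := by
  -- The empty case is separate: `infDist` to the empty set is `0`, so it would not detect points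
  -- outside `Y` below.
  rcases isEmpty_or_nonempty Y with hY | hY
  · refine ⟨∅, fun _ _ h => h.elim, ⟨⟨fun z => z.2.elim, ?_⟩, fun _ z => z.2.elim⟩, ?_,
      fun y => (hY.false y).elim⟩
    · exact continuous_iff_continuousAt.2 fun z => z.2.elim
    · simp [Set.range_eq_empty]
  have := hP.1
  let _ := TopologicalSpace.metrizableSpaceMetric Z
  obtain ⟨e, he⟩ := exists_isEmbedding_boundedContinuousFunction P
  let L := GSpace.coind G (BoundedContinuousFunction P ℝ × ℝ)
  let e₀ : C(P, BoundedContinuousFunction P ℝ × ℝ) := e.prodMk (ContinuousMap.const P 0)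
  have he₀ : IsEmbedding e₀ := by
    refine IsEmbedding.of_comp e₀.continuous (g := Prod.fst) continuous_fst ?_
    exact he
  let Φ : GMap P L := GMap.toCoind e₀
  have hΦ : IsEmbedding Φ := GMap.isEmbedding_toCoind e₀ he₀
  -- The image of `P` need not be closed in `L`. Removing the points outside it whose real
  -- coordinate vanishes identically makes it closed: in `W` it is the zero set of that coordinate.
  let W : Set L := {v | (∀ g : G, (GSpace.ev g v).2 = 0) → v ∈ Set.range Φ}
  have hW : ∀ (g : G) (v : L), v ∈ W → g • v ∈ W := fun g v hv h => by
    obtain ⟨p, hp⟩ := hv fun k => by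
      have h' : (GSpace.ev (k * g⁻¹ * g) v).2 = 0 := h (k * g⁻¹)
      rwa [inv_mul_cancel_right] at h'
    exact ⟨g • p, by rw [Φ.equivariant, hp]⟩
  have hΦ0 : ∀ p (g : G), (GSpace.ev g (Φ p)).2 = 0 := fun _ _ => rfl
  let j : GMap P (L.sub W hW) := Φ.codRestrict W hW fun p _ => ⟨p, rfl⟩
  have hj : IsClosedEmbedding j := by
    refine ⟨IsEmbedding.of_comp j.toMap.continuous continuous_subtype_val hΦ, ?_⟩
    have : Set.range j = {v | ∀ g : G, (GSpace.ev g v.1).2 = 0} := by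
      ext v
      constructor
      · rintro ⟨p, rfl⟩ g
        exact hΦ0 p g
      · intro h
        obtain ⟨p, hp⟩ := v.2 h
        exact ⟨p, Subtype.ext hp⟩
    rw [this, Set.ofPred_forall]
    refine isClosed_iInter fun g => isClosed_eq ?_ continuous_const
    exact continuous_snd.comp ((GSpace.ev g).continuous.comp continuous_subtype_val)
  have hWm : TopologicalSpace.MetrizableSpace (L.sub W hW) := by
    have : TopologicalSpace.MetrizableSpace L :=
      inferInstanceAs (TopologicalSpace.MetrizableSpace (GSpace.coind G _))
    exact inferInstanceAs (TopologicalSpace.MetrizableSpace W)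
  obtain ⟨V, hV, hPV, r, hVn, hr, hre, hrj⟩ := hP.2 (L.sub W hW)
    hWm j hj
  obtain ⟨F₀, hF₀⟩ := exists_continuousMap_extension hi (e.comp f.toMap)
  -- The real coordinate is the distance to `Y`, which vanishes only on `Y`; this forces the
  -- extension into `W`, where the `G`-ANR property of `P` applies.
  let F₁ : GMap Z L := GMap.toCoind
    (F₀.prodMk ⟨fun z => infDist z (Set.range i), continuous_infDist_pt _⟩)
  have hF₁i : ∀ y, F₁ (i y) = Φ (f y) := fun y => GSpace.coind_ext fun g => by
    rw [GMap.toCoind_apply, GMap.toCoind_apply, ← i.equivariant, ← f.equivariant]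
    exact Prod.ext (hF₀ _) (infDist_zero_of_mem ⟨_, rfl⟩)
  have hF₁W : ∀ z, F₁ z ∈ W := fun z h => by
    have h1 : infDist ((1 : G) • z) (Set.range i) = 0 := h 1
    rw [one_smul, ← hi.isClosed_range.mem_iff_infDist_zero (Set.range_nonempty i)] at h1
    obtain ⟨y, rfl⟩ := h1
    exact ⟨f y, (hF₁i y).symm⟩
  let F : GMap Z (L.sub W hW) := F₁.codRestrict W hW hF₁W
  have hFi : ∀ y, F (i y) = j (f y) := fun y => Subtype.ext (hF₁i y)
  refine ⟨F ⁻¹' V, fun g z hz => ?_, ⟨⟨fun z => r ⟨F z.1, z.2⟩, ?_⟩, fun g z => ?_⟩, ?_, ?_⟩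
  · change F (g • z) ∈ V
    rw [F.equivariant]
    exact hV g _ hz
  · exact hr.comp ((F.toMap.continuous.comp continuous_subtype_val).subtype_mk _)
  · exact (congrArg r (Subtype.ext (F.equivariant g z.1))).trans (hre g ⟨F z.1, z.2⟩)
  · rw [mem_nhdsSet_iff_forall] at hVn ⊢
    rintro _ ⟨y, rfl⟩
    refine F.toMap.continuous.continuousAt.preimage_mem_nhds ?_
    rw [hFi]
    exact hVn _ ⟨f y, rfl⟩
  · intro y hy
    refine Eq.trans (congrArg r (Subtype.ext (hFi y))) (hrj (f y))

end GSpace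

/-! ### Associated `G`-ANR sequences of compact metrizable `G`-spaces. -/

section Association

variable {G : Type u} [Group G] [TopologicalSpace G]

namespace GMap

/-- The function of two variables underlying a `G`-map defined on a cylinder. -/
def cylApply {X Y : GSpace G} (H : GMap X.cyl Y) (t : unitInterval) (x : X) : Y :=
  H.toMap (show unitInterval × X from (t, x))

theorem cylApply_smul {X Y : GSpace G} (H : GMap X.cyl Y) (t : unitInterval) (g : G) (x : X) :
    H.cylApply t (g • x) = g • H.cylApply t x :=
  H.equivariant g (show unitInterval × X from (t, x))

/-- A `G`-homotopy is a `G`-map defined on the cylinder. -/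
theorem homotopic_iff {X Y : GSpace G} {f h : GMap X Y} :
    f.Homotopic h ↔
      ∃ H : GMap X.cyl Y, (∀ x, H.cylApply 0 x = f x) ∧ ∀ x, H.cylApply 1 x = h x := by
  constructor
  · rintro ⟨H⟩
    exact ⟨⟨H.toContinuousMap, fun g a => H.prop' a.1 g a.2⟩, H.map_zero_left, H.map_one_left⟩
  · rintro ⟨H, h0, h1⟩
    exact ⟨{ toContinuousMap := H.toMap, map_zero_left := h0, map_one_left := h1,
             prop' := fun t g x => H.equivariant g (t, x) }⟩

theorem Homotopic.refl {X Y : GSpace G} (f : GMap X Y) : f.Homotopic f :=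
  ContinuousMap.HomotopicWith.refl _ f.equivariant

theorem Homotopic.symm {X Y : GSpace G} {f h : GMap X Y} (H : f.Homotopic h) : h.Homotopic f :=
  ContinuousMap.HomotopicWith.symm H

theorem Homotopic.trans {X Y : GSpace G} {f h k : GMap X Y} (H : f.Homotopic h)
    (H' : h.Homotopic k) : f.Homotopic k :=
  ContinuousMap.HomotopicWith.trans H H'

theorem Homotopic.comp {X Y Z : GSpace G} {f f' : GMap Y Z} {h h' : GMap X Y}
    (Hf : f.Homotopic f') (Hh : h.Homotopic h') : (f.comp h).Homotopic (f'.comp h') := by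
  obtain ⟨F⟩ := Hf
  obtain ⟨H⟩ := Hh
  refine ⟨{ toHomotopy := F.toHomotopy.comp H.toHomotopy, prop' := fun t g x => ?_ }⟩
  exact (congrArg (fun y => F (t, y)) (H.prop' t g x)).trans (F.prop' t g (H (t, x)))

/-- The inclusion of an invariant subset in a larger one. -/
def subInclusion {Z : GSpace G} {A B : Set Z} (hA : ∀ (g : G) (z : Z), z ∈ A → g • z ∈ A)
    (hB : ∀ (g : G) (z : Z), z ∈ B → g • z ∈ B) (hAB : A ⊆ B) : GMap (Z.sub A hA) (Z.sub B hB) :=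
  (subVal Z A hA).codRestrict B hB fun z => hAB z.2

variable [IsTopologicalGroup G] [CompactSpace G]

/-- `G`-maps to a `G`-ANR which are `G`-homotopic on a closed invariant subset are `G`-homotopic on
a neighbourhood of this subset. -/
theorem exists_nhds_homotopic {X M P : GSpace G} (hP : IsGANR P)
    (hM : TopologicalSpace.MetrizableSpace M) (i : GMap X M) (hi : IsClosedEmbedding i)
    (φ ψ : GMap M P) (h : (φ.comp i).Homotopic (ψ.comp i)) :
    ∃ (U : Set M) (hU : ∀ (g : G) (z : M), z ∈ U → g • z ∈ U),
      U ∈ 𝓝ˢ (Set.range i) ∧ (φ.comp (subVal M U hU)).Homotopic (ψ.comp (subVal M U hU)) := by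
  obtain ⟨H, hH0, hH1⟩ := homotopic_iff.1 h
  let q : unitInterval × X → unitInterval × M := Prod.map _root_.id i
  have hq : IsClosedEmbedding q := IsClosedEmbedding.id.prodMap hi
  let A₀ : Set (unitInterval × M) := {a | a.1 = 0}
  let A₁ : Set (unitInterval × M) := {a | a.1 = 1}
  have hA₀ : IsClosed A₀ := isClosed_eq continuous_fst continuous_const
  have hA₁ : IsClosed A₁ := isClosed_eq continuous_fst continuous_const
  let A : Set M.cyl := A₀ ∪ A₁ ∪ Set.range q
  have hAc : IsClosed A := (hA₀.union hA₁).union hq.isClosed_range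
  have hAinv : ∀ (g : G) (z : M.cyl), z ∈ A → g • z ∈ A := by
    rintro g z ((hz | hz) | ⟨⟨t, x⟩, rfl⟩)
    · exact Or.inl (Or.inl hz)
    · exact Or.inl (Or.inr hz)
    · exact Or.inr ⟨(t, g • x), Prod.ext rfl (i.equivariant g x)⟩
  classical
  -- The two maps at the ends of the cylinder are glued with the homotopy over `X`; the final
  -- default value lies off `A` and plays no role.
  let k : unitInterval × M → P := fun a => if a.1 = 0 then φ a.2 else if a.1 = 1 then ψ a.2 else
    if h : a.2 ∈ Set.range i then H.cylApply a.1 h.choose else φ a.2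
  have hk0 : ∀ a : unitInterval × M, a.1 = 0 → k a = φ a.2 := fun a ha => if_pos ha
  have hk1 : ∀ a : unitInterval × M, a.1 = 1 → k a = ψ a.2 := fun a ha => by
    simp only [k, ha, one_ne_zero, if_false, if_true]
  have hkq : ∀ a : unitInterval × X, k (q a) = H.cylApply a.1 a.2 := by
    rintro ⟨t, x⟩
    by_cases h0 : t = 0
    · subst h0
      exact (hk0 _ rfl).trans (hH0 x).symm
    by_cases h1 : t = 1
    · subst h1
      exact (hk1 _ rfl).trans (hH1 x).symm
    have hx : i x ∈ Set.range i := ⟨x, rfl⟩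
    have : k (q (t, x)) = H.cylApply t hx.choose := by
      simp only [k, q, Prod.map_apply, id_eq, if_neg h0, if_neg h1, dif_pos hx]
    rw [this, hi.injective hx.choose_spec]
  have hkc : ContinuousOn k A := by
    refine ContinuousOn.union_of_isClosed (ContinuousOn.union_of_isClosed ?_ ?_ hA₀ hA₁) ?_
      (hA₀.union hA₁) hq.isClosed_range
    · exact (φ.toMap.continuous.comp continuous_snd).continuousOn.congr hk0
    · exact (ψ.toMap.continuous.comp continuous_snd).continuousOn.congr hk1
    · refine continuousOn_iff_continuous_domRestrict.2 <|
        (hq.isEmbedding.toHomeomorph.isQuotientMap.continuous_iff).2 <|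
          H.toMap.continuous.congr fun a => (hkq a).symm
  have hke : ∀ (g : G) (a : M.cyl), a ∈ A → k (g • a) = g • k a := by
    rintro g a ((ha | ha) | ⟨⟨t, x⟩, rfl⟩)
    · rw [hk0 a ha, ← φ.equivariant]
      exact hk0 _ ha
    · rw [hk1 a ha, ← ψ.equivariant]
      exact hk1 _ ha
    · rw [hkq, ← cylApply_smul]
      refine Eq.trans (congrArg k ?_) (hkq (t, g • x))
      exact Prod.ext rfl (i.equivariant g x).symm
  let f : GMap (M.cyl.sub A hAinv) P :=
    ⟨⟨fun a => k a.1, continuousOn_iff_continuous_domRestrict.1 hkc⟩, fun g a => hke g a.1 a.2⟩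
  obtain ⟨V, hV, F, hVn, hF⟩ := hP.exists_extension
    (inferInstanceAs (TopologicalSpace.MetrizableSpace (unitInterval × M)))
    (subVal M.cyl A hAinv) hAc.isClosedEmbedding_subtypeVal f
  have hVA : ∀ a ∈ A, V ∈ 𝓝 a := fun a ha => mem_nhdsSet_iff_forall.1 hVn a ⟨⟨a, ha⟩, rfl⟩
  have hFk : ∀ (a : M.cyl) (_ : a ∈ A) (hv : a ∈ V), F ⟨a, hv⟩ = k a :=
    fun a ha hv => hF ⟨a, ha⟩ hv
  -- By the tube lemma, the points whose whole segment lies in `V` form a neighbourhood of `X`.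
  let U : Set M := {x | ∀ t : unitInterval, (t, x) ∈ V}
  have hU : ∀ (g : G) (z : M), z ∈ U → g • z ∈ U := fun g z hz t => hV g _ (hz t)
  refine ⟨U, hU, ?_, homotopic_iff.2 ⟨⟨⟨fun a => F ⟨(a.1, a.2.1), a.2.2 a.1⟩, ?_⟩, ?_⟩, ?_, ?_⟩⟩
  · rw [mem_nhdsSet_iff_forall]
    rintro _ ⟨x, rfl⟩
    have := isCompact_univ.eventually_forall_of_forall_eventually (X := M) (Y := unitInterval)
      (x₀ := i x) (K := Set.univ) (P := fun z t => (t, z) ∈ V) fun t _ => by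
        have h1 : V ∈ 𝓝 (t, i x) := hVA _ (Or.inr ⟨(t, x), rfl⟩)
        exact continuous_swap.continuousAt.preimage_mem_nhds h1
    filter_upwards [this] with z hz t using hz t trivial
  · refine F.toMap.continuous.comp (Continuous.subtype_mk ?_ _)
    exact continuous_fst.prodMk (continuous_subtype_val.comp continuous_snd)
  · exact fun g a => F.equivariant g ⟨(a.1, a.2.1), a.2.2 a.1⟩
  · exact fun x => (hFk (0, x.1) (Or.inl (Or.inl rfl)) (x.2 0)).trans (hk0 _ rfl)
  · exact fun x => (hFk (1, x.1) (Or.inl (Or.inr rfl)) (x.2 1)).trans (hk1 _ rfl)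

end GMap

variable [IsTopologicalGroup G] [CompactSpace G]

theorem GSpace.smul_mem_thickening {E : Type u} [NormedAddCommGroup E]
    {A : Set (GSpace.coind G E)} (hA : ∀ (g : G) (v : GSpace.coind G E), v ∈ A → g • v ∈ A)
    (δ : ℝ) (g : G) (v : GSpace.coind G E) (hv : v ∈ thickening δ A) :
    g • v ∈ thickening δ A := by
  rw [mem_thickening_iff] at hv ⊢
  obtain ⟨a, ha, hd⟩ := hv
  exact ⟨g • a, hA g a ha, by rwa [GSpace.dist_smul_smul]⟩

/-- The sequence of the `1 / (k + 1)`-neighbourhoods of an invariant subset of a coinduced normed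
space. -/
noncomputable def GANRSystem.ofThickening {E : Type u} [NormedAddCommGroup E] [NormedSpace ℝ E]
    (A : Set (GSpace.coind G E)) (hA : ∀ (g : G) (v : GSpace.coind G E), v ∈ A → g • v ∈ A) :
    GANRSystem G ℕ where
  obj k := (GSpace.coind G E).sub (thickening (1 / ((k : ℝ) + 1)) A)
    (GSpace.smul_mem_thickening hA _)
  isGANR _ := isGANR_sub_coind _ _ isOpen_thickening
  bond _ _ h := GMap.subInclusion _ _ (thickening_mono (Nat.one_div_le_one_div h) A)
  bond_self _ := rfl
  bond_comp _ _ _ _ _ := rfl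

/-- A compact metrizable `G`-space has an associated `G`-ANR sequence. -/
theorem exists_isAssociated_nat (X : GSpace G) [CompactSpace X]
    [TopologicalSpace.MetrizableSpace X] : ∃ S : GANRSystem G ℕ, S.IsAssociated X := by
  obtain ⟨e, he⟩ := exists_isEmbedding_boundedContinuousFunction X
  let Φ : GMap X (GSpace.coind G (BoundedContinuousFunction X ℝ)) := GMap.toCoind e
  have hΦ : IsEmbedding Φ := GMap.isEmbedding_toCoind e he
  have hcomp : IsCompact (Set.range Φ) := isCompact_range Φ.toMap.continuous
  have hinv : ∀ (g : G) (v : GSpace.coind G (BoundedContinuousFunction X ℝ)),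
      v ∈ Set.range Φ → g • v ∈ Set.range Φ := by
    rintro g _ ⟨x, rfl⟩
    exact ⟨g • x, Φ.equivariant g x⟩
  -- Compactness of the image makes its metric neighbourhoods a neighbourhood basis; this drives
  -- both conditions of association.
  have hsmall : ∀ U ∈ 𝓝ˢ (Set.range Φ), ∀ k₀ : ℕ, ∃ k : ℕ, k₀ ≤ k ∧
      thickening (1 / ((k : ℝ) + 1)) (Set.range Φ) ⊆ U := fun U hU k₀ => by
    have hbasis : (𝓝ˢ (Set.range Φ)).HasBasis (fun δ : ℝ => 0 < δ)
        fun δ => thickening δ (Set.range Φ) :=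
      hasBasis_nhdsSet_thickening (α := GSpace.coind G (BoundedContinuousFunction X ℝ)) hcomp
    obtain ⟨δ, hδ, hsub⟩ := hbasis.mem_iff.1 hU
    obtain ⟨n, hn⟩ := exists_nat_one_div_lt hδ
    refine ⟨max k₀ n, le_max_left _ _, (thickening_mono ?_ _).trans hsub⟩
    exact (Nat.one_div_le_one_div (le_max_right k₀ n)).trans hn.le
  have hpos : ∀ k : ℕ, (0 : ℝ) < 1 / ((k : ℝ) + 1) := fun k => Nat.one_div_pos_of_nat
  let S := GANRSystem.ofThickening (Set.range Φ) hinv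
  let p : ∀ k, GMap X (S.obj k) := fun k =>
    Φ.codRestrict _ _ fun x => self_subset_thickening (hpos k) _ ⟨x, rfl⟩
  refine ⟨S, p, fun _ _ _ => GMap.Homotopic.refl _, fun P hP => ⟨fun f => ?_, fun k φ ψ h => ?_⟩⟩
  · obtain ⟨U, hU, F, hUn, hF⟩ := hP.exists_extension inferInstance Φ
      ⟨hΦ, hcomp.isClosed⟩ f
    obtain ⟨k, -, hk⟩ := hsmall U hUn 0
    let h : GMap (S.obj k) P := F.comp (GMap.subInclusion _ _ hk)
    have : h.comp (p k) = f := GMap.ext fun x => hF x _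
    exact ⟨k, h, this ▸ GMap.Homotopic.refl _⟩
  · have hm : TopologicalSpace.MetrizableSpace (S.obj k) := (S.isGANR k).1
    have hp : IsClosedEmbedding (p k) :=
      ⟨IsEmbedding.of_comp (p k).toMap.continuous continuous_subtype_val hΦ,
        (isCompact_range (p k).toMap.continuous).isClosed⟩
    obtain ⟨U, hU, hUn, hUh⟩ := GMap.exists_nhds_homotopic hP hm (p k) hp φ ψ h
    -- The neighbourhood lives in a term of the sequence; that term is open, so it remains a
    -- neighbourhood in the coinduced space.
    have hV : Subtype.val '' U ∈ 𝓝ˢ (Set.range Φ) := by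
      rw [mem_nhdsSet_iff_forall] at hUn ⊢
      rintro _ ⟨x, rfl⟩
      exact (isOpen_thickening.isOpenEmbedding_subtypeVal.isOpenMap).image_mem_nhds
        (hUn _ ⟨x, rfl⟩)
    obtain ⟨k', hkk', hk'⟩ := hsmall _ hV k
    have hin : ∀ v : S.obj k', S.bond k k' hkk' v ∈ U := fun v => by
      obtain ⟨w, hw, hwv⟩ := hk' v.2
      have hvw : w = S.bond k k' hkk' v := Subtype.ext hwv
      exact hvw ▸ hw
    exact ⟨k', hkk', hUh.comp (GMap.Homotopic.refl ((S.bond k k' hkk').codRestrict U hU hin))⟩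

end Association

/-! ### The `G`-homotopy category, maps of systems and movability. -/

open CategoryTheory

section Shape

variable {G : Type u} [Group G] [TopologicalSpace G]

/-- `G`-homotopy as a setoid. -/
def GMap.homotopySetoid (X Y : GSpace G) : Setoid (GMap X Y) :=
  ⟨GMap.Homotopic, GMap.Homotopic.refl, GMap.Homotopic.symm, GMap.Homotopic.trans⟩

/-- The `G`-homotopy category: `G`-spaces and `G`-homotopy classes of `G`-maps. -/
instance : Category (GSpace G) where
  Hom X Y := Quotient (GMap.homotopySetoid X Y)
  id X := Quotient.mk _ (GMap.id X)
  comp f h := Quotient.map₂ (fun f h => h.comp f) (fun _ _ H _ _ H' => GMap.Homotopic.comp H' H) f h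
  id_comp := by rintro _ _ ⟨f⟩; rfl
  comp_id := by rintro _ _ ⟨f⟩; rfl
  assoc := by rintro _ _ _ _ ⟨f⟩ ⟨h⟩ ⟨k⟩; rfl

namespace GMap

/-- The `G`-homotopy class of a `G`-map. -/
def cls {X Y : GSpace G} (f : GMap X Y) : X ⟶ Y := Quotient.mk (homotopySetoid X Y) f

theorem cls_surjective {X Y : GSpace G} (f : X ⟶ Y) : ∃ f' : GMap X Y, f'.cls = f :=
  Quotient.exists_rep f

theorem cls_comp {X Y Z : GSpace G} (f : GMap Y Z) (h : GMap X Y) :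
    (f.comp h).cls = h.cls ≫ f.cls := rfl

theorem cls_id (X : GSpace G) : (GMap.id X).cls = 𝟙 X := rfl

theorem cls_eq_iff {X Y : GSpace G} {f h : GMap X Y} : f.cls = h.cls ↔ f.Homotopic h :=
  Quotient.eq (r := homotopySetoid X Y)

end GMap

namespace GANRSystem

variable {A B C : Type*} [Preorder A] [Preorder B] [Preorder C]

/-- The class of a bonding map. -/
def hbond (S : GANRSystem G A) {α α' : A} (h : α ≤ α') : S.obj α' ⟶ S.obj α := (S.bond α α' h).cls

@[simp]
theorem hbond_comp (S : GANRSystem G A) {α α' α'' : A} (h : α ≤ α') (h' : α' ≤ α'') :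
    S.hbond h' ≫ S.hbond h = S.hbond (h.trans h') := by
  rw [hbond, hbond, ← GMap.cls_comp, S.bond_comp, hbond]

@[simp]
theorem hbond_comp_assoc (S : GANRSystem G A) {α α' α'' : A} (h : α ≤ α') (h' : α' ≤ α'')
    {P : GSpace G} (f : S.obj α ⟶ P) :
    S.hbond h' ≫ S.hbond h ≫ f = S.hbond (h.trans h') ≫ f := by
  rw [← Category.assoc, hbond_comp]

theorem hbond_comp_eq_of_le (S : GANRSystem G A) {α α' α'' : A} {h : α ≤ α'} {P : GSpace G}
    {φ ψ : S.obj α ⟶ P} (H : S.hbond h ≫ φ = S.hbond h ≫ ψ) (h' : α' ≤ α'') :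
    S.hbond (h.trans h') ≫ φ = S.hbond (h.trans h') ≫ ψ := by
  rw [← hbond_comp_assoc S h h', H, hbond_comp_assoc]

@[simp]
theorem hbond_self (S : GANRSystem G A) {α : A} (h : α ≤ α) : S.hbond h = 𝟙 (S.obj α) := by
  rw [hbond, S.bond_self, GMap.cls_id]

/-- The classes `p α` exhibit `S` as associated with `X`. -/
structure IsExpansion (S : GANRSystem G A) (X : GSpace G) (p : ∀ α, X ⟶ S.obj α) : Prop where
  comp_hbond : ∀ {α α' : A} (h : α ≤ α'), p α' ≫ S.hbond h = p α
  exists_factor : ∀ {P : GSpace G}, IsGANR P → ∀ f : X ⟶ P,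
    ∃ (α : A) (h : S.obj α ⟶ P), p α ≫ h = f
  exists_eq : ∀ {P : GSpace G}, IsGANR P → ∀ {α : A} (φ ψ : S.obj α ⟶ P),
    p α ≫ φ = p α ≫ ψ → ∃ (α' : A) (h : α ≤ α'), S.hbond h ≫ φ = S.hbond h ≫ ψ

/-- Passing to homotopy classes turns association into equations between morphisms, so later
arguments are diagram chases. -/
theorem isAssociated_iff {S : GANRSystem G A} {X : GSpace G} :
    S.IsAssociated X ↔ ∃ p, S.IsExpansion X p := by
  constructor
  · rintro ⟨p, hp, hP⟩
    refine ⟨fun α => (p α).cls, fun h => (GMap.cls_eq_iff.2 (hp _ _ h)).symm, fun hQ f => ?_,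
      fun {P} hQ {α} φ ψ h => ?_⟩
    · obtain ⟨f, rfl⟩ := GMap.cls_surjective f
      obtain ⟨α, h, hf⟩ := (hP _ hQ).1 f
      exact ⟨α, h.cls, GMap.cls_eq_iff.2 hf⟩
    · obtain ⟨φ, rfl⟩ := GMap.cls_surjective φ
      obtain ⟨ψ, rfl⟩ := GMap.cls_surjective ψ
      obtain ⟨α', h', hf⟩ := (hP _ hQ).2 α φ ψ (GMap.cls_eq_iff.1 h)
      exact ⟨α', h', GMap.cls_eq_iff.2 hf⟩
  · rintro ⟨p, hp⟩
    choose p' hp' using fun α => GMap.cls_surjective (p α)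
    obtain rfl : (fun α => (p' α).cls) = p := funext hp'
    refine ⟨p', fun α α' h => GMap.cls_eq_iff.1 (hp.comp_hbond h).symm,
      fun P hP => ⟨fun f => ?_, fun α φ ψ h => ?_⟩⟩
    · obtain ⟨α, h, hf⟩ := hp.exists_factor hP f.cls
      obtain ⟨h, rfl⟩ := GMap.cls_surjective h
      exact ⟨α, h, GMap.cls_eq_iff.1 hf⟩
    · obtain ⟨α', h', hf⟩ := hp.exists_eq hP φ.cls ψ.cls (GMap.cls_eq_iff.2 h)
      exact ⟨α', h', GMap.cls_eq_iff.1 hf⟩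

theorem isMovable_iff {S : GANRSystem G A} :
    S.IsMovable ↔ ∀ α : A, ∃ (α' : A) (h' : α ≤ α'), ∀ (α'' : A) (h'' : α ≤ α''),
      ∃ r : S.obj α' ⟶ S.obj α'', r ≫ S.hbond h'' = S.hbond h' := by
  refine forall_congr' fun α => exists_congr fun α' => exists_congr fun h' =>
    forall_congr' fun α'' => forall_congr' fun h'' => ⟨?_, ?_⟩
  · rintro ⟨r, hr⟩
    exact ⟨r.cls, GMap.cls_eq_iff.2 hr⟩
  · rintro ⟨r, hr⟩
    obtain ⟨r, rfl⟩ := GMap.cls_surjective r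
    exact ⟨r, GMap.cls_eq_iff.1 hr⟩

theorem nonempty_map_iff {S : GANRSystem G A} {T : GANRSystem G B} :
    Nonempty (S.Map T) ↔ ∃ (φ : B → A) (f : ∀ β, S.obj (φ β) ⟶ T.obj β),
      ∀ (β β' : B) (h : β ≤ β'), ∃ (α : A) (h₁ : φ β ≤ α) (h₂ : φ β' ≤ α),
        S.hbond h₁ ≫ f β = S.hbond h₂ ≫ f β' ≫ T.hbond h := by
  constructor
  · rintro ⟨φ, f, hf⟩
    refine ⟨φ, fun β => (f β).cls, fun β β' h => ?_⟩
    obtain ⟨α, h₁, h₂, H⟩ := hf β β' h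
    exact ⟨α, h₁, h₂, GMap.cls_eq_iff.2 H⟩
  · rintro ⟨φ, f, hf⟩
    choose f' hf' using fun β => GMap.cls_surjective (f β)
    obtain rfl : (fun β => (f' β).cls) = f := funext hf'
    refine ⟨φ, f', fun β β' h => ?_⟩
    obtain ⟨α, h₁, h₂, H⟩ := hf β β' h
    exact ⟨α, h₁, h₂, GMap.cls_eq_iff.1 H⟩

/-- A `G`-map induces a map between associated systems. -/
theorem IsAssociated.nonempty_map [IsDirectedOrder A] {S : GANRSystem G A} {T : GANRSystem G B}
    {X Y : GSpace G} (hS : S.IsAssociated X) (hT : T.IsAssociated Y) (f : X ⟶ Y) :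
    Nonempty (S.Map T) := by
  obtain ⟨p, hp⟩ := isAssociated_iff.1 hS
  obtain ⟨q, hq⟩ := isAssociated_iff.1 hT
  choose φ k hk using fun β => hp.exists_factor (T.isGANR β) (f ≫ q β)
  refine nonempty_map_iff.2 ⟨φ, k, fun β β' h => ?_⟩
  obtain ⟨α, h₁, h₂⟩ := exists_ge_ge (φ β) (φ β')
  -- The two factorizations agree on `X`, hence agree at a later stage of `S`.
  obtain ⟨α', h', H⟩ := hp.exists_eq (T.isGANR β) (S.hbond h₁ ≫ k β)
    (S.hbond h₂ ≫ k β' ≫ T.hbond h) (by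
      rw [← Category.assoc, hp.comp_hbond, hk, ← Category.assoc, hp.comp_hbond, ← Category.assoc,
        hk, Category.assoc, hq.comp_hbond])
  exact ⟨α', h₁.trans h', h₂.trans h', by simpa using H⟩

theorem nonempty_map_trans [IsDirectedOrder A] {S : GANRSystem G A} {T : GANRSystem G B}
    {U : GANRSystem G C} (hST : Nonempty (S.Map T)) (hTU : Nonempty (T.Map U)) :
    Nonempty (S.Map U) := by
  obtain ⟨φ, f, hf⟩ := nonempty_map_iff.1 hST
  obtain ⟨χ, k, hk⟩ := nonempty_map_iff.1 hTU
  refine nonempty_map_iff.2 ⟨φ ∘ χ, fun γ => f (χ γ) ≫ k γ, fun γ γ' h => ?_⟩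
  obtain ⟨β, h₁, h₂, H⟩ := hk γ γ' h
  obtain ⟨α₁, i₁, j₁, H₁⟩ := hf _ _ h₁
  obtain ⟨α₂, i₂, j₂, H₂⟩ := hf _ _ h₂
  obtain ⟨α, l₁, l₂⟩ := exists_ge_ge α₁ α₂
  have H₁' : S.hbond (i₁.trans l₁) ≫ f (χ γ) = S.hbond (j₁.trans l₁) ≫ f β ≫ T.hbond h₁ := by
    rw [← hbond_comp_assoc S i₁ l₁, H₁, hbond_comp_assoc]
  have H₂' : S.hbond (i₂.trans l₂) ≫ f (χ γ') = S.hbond (j₂.trans l₂) ≫ f β ≫ T.hbond h₂ := by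
    rw [← hbond_comp_assoc S i₂ l₂, H₂, hbond_comp_assoc]
  refine ⟨α, i₁.trans l₁, i₂.trans l₂, ?_⟩
  calc S.hbond (i₁.trans l₁) ≫ f (χ γ) ≫ k γ
      = (S.hbond (i₁.trans l₁) ≫ f (χ γ)) ≫ k γ := (Category.assoc _ _ _).symm
    _ = S.hbond (j₁.trans l₁) ≫ f β ≫ T.hbond h₁ ≫ k γ := by rw [H₁']; simp only [Category.assoc]
    _ = (S.hbond (j₂.trans l₂) ≫ f β ≫ T.hbond h₂) ≫ k γ' ≫ U.hbond h := by
        rw [H]; simp only [Category.assoc]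
    _ = S.hbond (i₂.trans l₂) ≫ (f (χ γ') ≫ k γ') ≫ U.hbond h := by
        rw [← H₂']; simp only [Category.assoc]

/-- The system consisting of a single `G`-ANR. -/
def single (P : GSpace G) (hP : IsGANR P) : GANRSystem G PUnit.{u + 1} where
  obj _ := P
  isGANR _ := hP
  bond _ _ _ := GMap.id P
  bond_self _ := rfl
  bond_comp _ _ _ _ _ := rfl

theorem single_isAssociated (P : GSpace G) (hP : IsGANR P) : (single P hP).IsAssociated P :=
  isAssociated_iff.2 ⟨fun _ => 𝟙 P, fun _ => Category.id_comp _,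
    fun _ f => ⟨PUnit.unit, f, Category.id_comp _⟩,
    fun _ α φ ψ h => ⟨α, le_rfl, by
      have hφψ : φ = ψ := (Category.id_comp φ).symm.trans (h.trans (Category.id_comp ψ))
      rw [hφψ]⟩⟩

/-- The restriction of a system along a monotone map. -/
def reindex (S : GANRSystem G A) (e : B →o A) : GANRSystem G B where
  obj β := S.obj (e β)
  isGANR β := S.isGANR (e β)
  bond _ _ h := S.bond _ _ (e.monotone h)
  bond_self _ := S.bond_self _
  bond_comp _ _ _ _ _ := S.bond_comp _ _ _ _ _

theorem IsAssociated.reindex [IsDirectedOrder B] {S : GANRSystem G A} {X : GSpace G}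
    (hS : S.IsAssociated X) (e : B →o A) (he : ∀ α, ∃ β, α ≤ e β) :
    (S.reindex e).IsAssociated X := by
  obtain ⟨p, hp⟩ := isAssociated_iff.1 hS
  refine isAssociated_iff.2 ⟨fun β => p (e β), fun h => hp.comp_hbond _, fun hP f => ?_,
    fun {P} hP {β} φ ψ h => ?_⟩
  · obtain ⟨α, h, rfl⟩ := hp.exists_factor hP f
    obtain ⟨β, hβ⟩ := he α
    exact ⟨β, S.hbond hβ ≫ h, 
      (Category.assoc _ _ _).symm.trans (congrArg (· ≫ h) (hp.comp_hbond hβ))⟩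
  · obtain ⟨α, h, H⟩ := hp.exists_eq hP (α := e β) φ ψ h
    obtain ⟨β', hβ'⟩ := he α
    obtain ⟨β'', h₁, h₂⟩ := exists_ge_ge β β'
    exact ⟨β'', h₁, S.hbond_comp_eq_of_le H (hβ'.trans (e.monotone h₂))⟩

/-- Movability does not depend on the choice of the associated system. -/
theorem IsMovable.of_isAssociated [IsDirectedOrder A] [IsDirectedOrder B] {S : GANRSystem G A}
    {T : GANRSystem G B} {X : GSpace G} (hm : S.IsMovable) (hS : S.IsAssociated X)
    (hT : T.IsAssociated X) : T.IsMovable := by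
  obtain ⟨p, hp⟩ := isAssociated_iff.1 hS
  obtain ⟨q, hq⟩ := isAssociated_iff.1 hT
  rw [isMovable_iff] at hm ⊢
  intro β
  -- The index `β'` is chosen so that the bond `T_β' → T_β` factors up to homotopy as `T_γ → S_α' →
  -- S_α → T_β` after a bond, with `α'` a movability index for `α`.
  obtain ⟨α, f, hf⟩ := hp.exists_factor (T.isGANR β) (q β)
  obtain ⟨α', hα', hmov⟩ := hm α
  obtain ⟨γ, k, hk⟩ := hq.exists_factor (S.isGANR α') (p α')
  obtain ⟨γ', h₁, h₂⟩ := exists_ge_ge β γ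
  obtain ⟨β', hβ', H⟩ := hq.exists_eq (T.isGANR β) (T.hbond h₂ ≫ k ≫ S.hbond hα' ≫ f)
    (T.hbond h₁) (by
      rw [← Category.assoc, hq.comp_hbond, ← Category.assoc, hk, ← Category.assoc, hp.comp_hbond,
        hf, hq.comp_hbond])
  rw [hbond_comp_assoc, hbond_comp] at H
  refine ⟨β', h₁.trans hβ', fun β'' hβ'' => ?_⟩
  obtain ⟨δ, l, hl⟩ := hp.exists_factor (T.isGANR β'') (q β'')
  obtain ⟨δ', i₁, i₂⟩ := exists_ge_ge α δ
  obtain ⟨α'', hα'', hH⟩ := hp.exists_eq (T.isGANR β) (S.hbond i₂ ≫ l ≫ T.hbond hβ'')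
    (S.hbond i₁ ≫ f) (by
      rw [← Category.assoc, hp.comp_hbond, ← Category.assoc, hl, hq.comp_hbond, ← Category.assoc,
        hp.comp_hbond, hf])
  rw [hbond_comp_assoc, hbond_comp_assoc] at hH
  -- The lift to `T_β''` runs through `S_α' → S_α'' → S_δ`; `α''` is late enough for the two ways
  -- down to `T_β` to agree.
  obtain ⟨r, hr⟩ := hmov α'' (i₁.trans hα'')
  refine ⟨T.hbond (h₂.trans hβ') ≫ k ≫ r ≫ S.hbond (i₂.trans hα'') ≫ l, ?_⟩
  rw [← H, ← hr]
  simp only [Category.assoc, hH]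

/-- In a movable sequence, some term maps to the whole sequence. -/
theorem IsMovable.exists_lift {T : GANRSystem G ℕ} (hT : T.IsMovable) :
    ∃ (m : ℕ) (f : ∀ n, T.obj m ⟶ T.obj n), ∀ {n n' : ℕ} (h : n ≤ n'), f n' ≫ T.hbond h = f n := by
  have hT' : ∀ n : ℕ, ∃ n' : ℕ, n < n' ∧ ∀ (h' : n ≤ n') (n'' : ℕ) (h'' : n ≤ n''),
      ∃ r : T.obj n' ⟶ T.obj n'', r ≫ T.hbond h'' = T.hbond h' := fun n => by
    obtain ⟨n', h', H⟩ := isMovable_iff.1 hT n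
    refine ⟨n' + 1, by lia, fun h n'' h'' => ?_⟩
    obtain ⟨r, hr⟩ := H n'' h''
    exact ⟨T.hbond n'.le_succ ≫ r, by rw [Category.assoc, hr, hbond_comp]⟩
  -- Movability indices are taken strictly larger, so that iterating `μ` gives a cofinal sequence.
  choose μ hμ hr using hT'
  let j : ℕ → ℕ := fun n => μ^[n] 0
  have hj : ∀ n, j (n + 1) = μ (j n) := fun n => Function.iterate_succ_apply' μ n 0
  have hjlt : ∀ n, j n < j (n + 1) := fun n => by rw [hj]; exact hμ _
  have hjn : ∀ n, n ≤ j n := fun n =>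
    (strictMono_nat_of_lt_succ hjlt).le_apply
  have hr' : ∀ n, ∃ r : T.obj (j (n + 1)) ⟶ T.obj (j (n + 2)),
      r ≫ T.hbond ((hjlt n).le.trans (hjlt (n + 1)).le) = T.hbond (hjlt n).le := fun n => by
    have key : ∀ (m : ℕ) (_ : m = μ (j n)) (h' : j n ≤ m) (h'' : j n ≤ j (n + 2)),
        ∃ r : T.obj m ⟶ T.obj (j (n + 2)), r ≫ T.hbond h'' = T.hbond h' := by
      rintro m rfl h' h''
      exact hr _ _ _ _
    exact key _ (hj n) _ _
  choose r hr using hr'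
  let k : ∀ n, T.obj (j 1) ⟶ T.obj (j (n + 1)) := fun n =>
    Nat.rec (𝟙 (T.obj (j 1))) (fun n f => f ≫ r n) n
  have hk : ∀ n, k (n + 1) = k n ≫ r n := fun n => rfl
  -- `k n` and `k (n + 1)` need agree only after projection to stage `j n`, one step below the
  -- target of `k n`; since `n ≤ j n`, projecting on to stage `n` gives a compatible family.
  let f : ∀ n, T.obj (j 1) ⟶ T.obj n := fun n => k n ≫ T.hbond ((hjn n).trans (hjlt n).le)
  have hf : ∀ n, f (n + 1) ≫ T.hbond n.le_succ = f n := fun n => by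
    simp only [f, hk, Category.assoc, hbond_comp]
    rw [← hbond_comp T (hjn n) ((hjlt n).le.trans (hjlt (n + 1)).le), ← Category.assoc (r n), hr,
      hbond_comp]
  refine ⟨j 1, f, fun {n n'} h => ?_⟩
  induction n', h using Nat.le_induction with
  | base => rw [hbond_self, Category.comp_id]
  | succ n' h ih => rw [← hbond_comp T h n'.le_succ, ← Category.assoc, hf, ih]

end GANRSystem

/-! ### Shape morphisms and the main theorem. -/

theorem ExistsGShapeMorphism.trans {X Y Z : GSpace G} (h : ExistsGShapeMorphism X Y)
    (h' : ExistsGShapeMorphism Y Z) : ExistsGShapeMorphism X Z := by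
  obtain ⟨A, _, _, _, S, B, _, _, _, T, hS, hT, hm⟩ := h
  obtain ⟨A', _, _, _, S', B', _, _, _, T', hS', hT', hmap⟩ := h'
  -- The two systems associated with `Y` may differ; the identity of `Y` induces the connecting map.
  exact ⟨A, _, ‹_›, ‹_›, S, B', _, ‹_›, ‹_›, T', hS, hT', GANRSystem.nonempty_map_trans
    (GANRSystem.nonempty_map_trans hm (hT.nonempty_map hS' (𝟙 Y))) hmap⟩

/-- A `G`-shape morphism is represented by a map between any given associated systems. -/
theorem ExistsGShapeMorphism.nonempty_map {A B : Type*} [Preorder A] [Preorder B]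
    [IsDirectedOrder A] {S : GANRSystem G A} {T : GANRSystem G B}
    {X Y : GSpace G} (h : ExistsGShapeMorphism X Y) (hS : S.IsAssociated X)
    (hT : T.IsAssociated Y) : Nonempty (S.Map T) := by
  obtain ⟨A', _, _, _, S', B', _, _, _, T', hS', hT', hm⟩ := h
  exact GANRSystem.nonempty_map_trans (GANRSystem.nonempty_map_trans
    (hS.nonempty_map hS' (𝟙 X)) hm) (hT'.nonempty_map hT (𝟙 Y))

namespace GANRSystem

/-- The index set `ℕ` lifted to a larger universe. -/
def uliftNat : ULift.{u} ℕ →o ℕ := ⟨ULift.down, fun _ _ h => h⟩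

/-- Shape morphisms are defined with index sets in `Type u`, hence the lift of `ℕ`. -/
theorem IsAssociated.ulift {S : GANRSystem G ℕ} {X : GSpace G} (hS : S.IsAssociated X) :
    (S.reindex uliftNat.{u}).IsAssociated X :=
  hS.reindex _ fun n => ⟨⟨n⟩, le_rfl⟩

/-- If a sequence is associated with `X`, then a `G`-map from `X` to a `G`-ANR gives a `G`-shape
morphism. -/
theorem IsAssociated.existsGShapeMorphism {S : GANRSystem G ℕ} {X P : GSpace G}
    (hS : S.IsAssociated X) (hP : IsGANR P) (f : X ⟶ P) : ExistsGShapeMorphism X P :=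
  ⟨_, _, inferInstance, inferInstance, _, _, _, inferInstance, inferInstance, _, hS.ulift,
    single_isAssociated P hP, hS.ulift.nonempty_map (single_isAssociated P hP) f⟩

/-- Some term of a movable sequence associated with `Y` has a `G`-shape morphism to `Y`. -/
theorem IsMovable.exists_existsGShapeMorphism {T : GANRSystem G ℕ} {Y : GSpace G}
    (hm : T.IsMovable) (hT : T.IsAssociated Y) : ∃ m, ExistsGShapeMorphism (T.obj m) Y := by
  obtain ⟨m, f, hf⟩ := hm.exists_lift
  refine ⟨m, _, _, inferInstance, inferInstance, _, _, _, inferInstance, inferInstance, _,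
    single_isAssociated _ (T.isGANR m), hT.ulift, nonempty_map_iff.2
    ⟨fun _ => PUnit.unit, fun n => f n.down, fun n n' h => ⟨PUnit.unit, le_rfl, le_rfl, ?_⟩⟩⟩
  exact congrArg _ (hf (n := n.down) (n' := n'.down) h).symm

end GANRSystem

theorem existsGShapeMorphism_of_hom {P Q : GSpace G} (hP : IsGANR P) (hQ : IsGANR Q) (f : P ⟶ Q) :
    ExistsGShapeMorphism P Q :=
  ⟨_, _, inferInstance, inferInstance, _, _, _, inferInstance, inferInstance, _,
    GANRSystem.single_isAssociated P hP, GANRSystem.single_isAssociated Q hQ,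
    (GANRSystem.single_isAssociated P hP).nonempty_map (GANRSystem.single_isAssociated Q hQ) f⟩

end Shape

theorem mainTheorem7 {G : Type u} [Group G] [TopologicalSpace G] [IsTopologicalGroup G]
    [CompactSpace G] (K : Set (GSpace G)) (hK : ∃ Z : GSpace G, K = wes Z)
    (hmov : ∃ Y ∈ K, CompactSpace Y ∧ TopologicalSpace.MetrizableSpace Y ∧ IsGMovable Y)
    (X : GSpace G) (hX : X ∈ K) (hXc : CompactSpace X)
    (hXm : TopologicalSpace.MetrizableSpace X) :
    ∃ S : GANRSystem G ℕ, S.IsAssociated X ∧ ∀ k, S.obj k ∈ K := by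
  obtain ⟨Z, rfl⟩ := hK
  obtain ⟨Y, ⟨hZY, hYZ⟩, hYc, hYm, B, _, _, _, R, hR, hRm⟩ := hmov
  obtain ⟨hZX, hXZ⟩ := hX
  obtain ⟨S, hS⟩ := exists_isAssociated_nat X
  obtain ⟨T, hT⟩ := exists_isAssociated_nat Y
  obtain ⟨m, hm⟩ := (hRm.of_isAssociated hR hT).exists_existsGShapeMorphism hT
  obtain ⟨F⟩ := (hXZ.trans hZY).nonempty_map hS hT
  -- The tail starts at the index from which `F` maps to `T.obj m`, so every remaining term maps
  -- there through a bond.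
  let e : ℕ →o ℕ := ⟨fun k => F.φ m + k, fun _ _ h => Nat.add_le_add_left h _⟩
  have hSe : (S.reindex e).IsAssociated X := hS.reindex e fun k => ⟨k, Nat.le_add_left _ _⟩
  refine ⟨S.reindex e, hSe, fun k => ⟨?_, ?_⟩⟩
  · obtain ⟨p, -⟩ := hSe
    exact hZX.trans (hS.existsGShapeMorphism ((S.reindex e).isGANR k) (p k).cls)
  · exact ((existsGShapeMorphism_of_hom ((S.reindex e).isGANR k) (T.isGANR m)
      (S.hbond (Nat.le_add_right _ _) ≫ (F.f m).cls)).trans hm).trans hYZ
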